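/- Let $N\ge 2$ and let $\mathcal D_1,\dots,\mathcal D_N$ be reward distributions on $\mathbb R$ with means $\theta_1,\dots,\theta_N$. Assume that each of them is $\sigma$-sub-Gaussian for a known $\sigma>0$, that is, $\int e^{\lambda(x-\theta_i)}\,d\mathcal D_i(x)\le e^{\lambda^2\sigma^2/2}$ for all $\lambda\in\mathbb R$ (for example, Gaussian with variance $\sigma^2$). Assume that there is a unique optimal arm $b$, and put $\Delta_a:=\theta_b-\theta_a$ and $\Delta:=\min_{a\ne b}\Delta_a>0$. In each round $t=1,2,\dots$ an arm $\pi_t\in\{1,\dots,N\}$ is chosen and a reward $X_t$ is received, whose conditional law given $\pi_1,X_1,\dots,\pi_{t-1},X_{t-1},\pi_t$ is $\mathcal D_{\pi_t}$. The regret is $\mathcal R(T):=T\theta_b-\mathbb E\big[\sum_{t=1}^TX_t\big]$. Let $\gamma:=8\sigma^2$ and let $\beta:\{1,2,\dots\}\to\mathbb R$ be a nondecreasing function with $\beta(t)\to\infty$. The adaptive RBMLE algorithm, which knows $N$, $\sigma$ and $\beta$ but neither $\Delta$ nor the maximal mean, chooses the arm of round $t$ as follows. Let $N_i(t)$ be the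 number of pulls of arm $i$ before round $t$ and $p_i(t)$ the empirical mean of the rewards that they gave. If some arm has not been pulled yet, the algorithm pulls such an arm. Otherwise it computes $$U_i(t)=p_i(t)+\sqrt{\tfrac{2\sigma^2(N+2)\log t}{N_i(t)}},\qquad L_i(t)=p_i(t)-\sqrt{\tfrac{2\sigma^2(N+2)\log t}{N_i(t)}},$$ $$\widehat\Delta_t=\max_{i}\max\Big\{0,\;L_i(t)-\max_{j\ne i}U_j(t)\Big\},\qquad \widehat C_\alpha(t)=\frac{32\gamma(N+2)}{\widehat\Delta_t}\quad(=\infty\text{ if }\widehat\Delta_t=0),$$ $$\alpha(t)=\min\{\widehat C_\alpha(t),\beta(t)\}\log t,$$ and it pulls an arm that maximizes the index $p_i(t)+\frac{\alpha(t)}{2N_i(t)}$ (ties are broken arbitrarily). Then $T_0:=\min\{t\ge 1:\beta(t)\ge \tfrac{32\gamma(N+2)}{\Delta}\}$ exists (is finite), and for every $T\ge1$ $$\mathcal R(T)\;\le\;\sum_{a\ne b}\Delta_a\left[\max\Big\{\frac{128\,\gamma\,(N+2)}{\Delta^2}\log T,\;T_0\Big\}+\frac{N\pi^2}{3}\right].$$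 In particular $\mathcal R(T)=O(\log T)$ as $T\to\infty$. -/

import Mathlib

open MeasureTheory ProbabilityTheory Filter
open scoped NNReal Topology

namespace Bandit

noncomputable section

/-! ### Instances: reward distributions `D i`, one for each of the `N` arms -/

/-- The mean reward `θ_i` of arm `i`. -/
def armMean {N : ℕ} (D : Fin N → Measure ℝ) (i : Fin N) : ℝ := ∫ x, x ∂(D i)

/-- The gap `Δ_a = θ_b - θ_a` of arm `a`, where `b` is the optimal arm. -/
def gap {N : ℕ} (D : Fin N → Measure ℝ) (b a : Fin N) : ℝ := armMean D b - armMean D a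

/-- The minimum gap `Δ = min_{a ≠ b} Δ_a`, where `b` is the optimal arm. -/
def minGap {N : ℕ} (D : Fin N → Measure ℝ) (b : Fin N) : ℝ :=
  ⨅ a : {a : Fin N // a ≠ b}, gap D b a

/-- The kernel that draws a reward from `D a` when the past is `h` and the chosen arm is `a`. -/
def rewardKernel {N : ℕ} (D : Fin N → Measure ℝ) (H : Type*) [MeasurableSpace H] :
    Kernel (H × Fin N) ℝ :=
  (Kernel.ofFunOfCountable D).comap Prod.snd measurable_snd

instance {N : ℕ} (D : Fin N → Measure ℝ) [∀ i, IsProbabilityMeasure (D i)]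
    (H : Type*) [MeasurableSpace H] : IsMarkovKernel (rewardKernel D H) :=
  ⟨fun p => inferInstanceAs (IsProbabilityMeasure (D p.2))⟩

/-! ### Interaction.  Rounds are numbered `1, 2, 3, …`; the values at `0` are never used. -/

/-- The history before round `t`: arms and rewards of the rounds `1, …, t - 1`. -/
def history {N : ℕ} {Ω : Type*} (π : ℕ → Ω → Fin N) (X : ℕ → Ω → ℝ) (t : ℕ) (ω : Ω) :
    Finset.Ico 1 t → Fin N × ℝ :=
  fun s => (π s ω, X s ω)

/-- `π` (arms) and `X` (rewards) come from playing the bandit `D` on the probability space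
`(Ω, P)`: given the history before round `t` and the arm `π_t`, the reward `X_t` is drawn
from `D_{π_t}`. -/
structure IsPlay {N : ℕ} {Ω : Type*} [MeasurableSpace Ω] (P : Measure Ω)
    (D : Fin N → Measure ℝ) (π : ℕ → Ω → Fin N) (X : ℕ → Ω → ℝ) : Prop where
  measurable_arm : ∀ t, 1 ≤ t → Measurable (π t)
  measurable_reward : ∀ t, 1 ≤ t → Measurable (X t)
  reward_law : ∀ t, 1 ≤ t →
    HasCondDistrib (X t) (fun ω => (history π X t ω, π t ω)) (rewardKernel D _) P

/-- The regret `R(T) = T θ_b - E[∑_{t=1}^T X_t]`, where `b` is the optimal arm. -/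
def regret {N : ℕ} {Ω : Type*} [MeasurableSpace Ω] (P : Measure Ω)
    (D : Fin N → Measure ℝ) (b : Fin N) (X : ℕ → Ω → ℝ) (T : ℕ) : ℝ :=
  T * armMean D b - ∫ ω, ∑ t ∈ Finset.Icc 1 T, X t ω ∂P

/-! ### The adaptive algorithm.

The statistics available when the arm of round `t` is chosen, as functions of a realised
sequence of arms `p` and rewards `x`; only the rounds `1, …, t - 1` enter. -/

/-- `N_i(t)`: how often arm `i` was pulled before round `t`. -/
def pulls {N : ℕ} (p : ℕ → Fin N) (i : Fin N) (t : ℕ) : ℕ :=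
  ((Finset.Ico 1 t).filter fun s => p s = i).card

/-- `p_i(t)`: the empirical mean reward of arm `i` before round `t`. -/
def empMean {N : ℕ} (p : ℕ → Fin N) (x : ℕ → ℝ) (i : Fin N) (t : ℕ) : ℝ :=
  (∑ s ∈ (Finset.Ico 1 t).filter (fun s => p s = i), x s) / pulls p i t

/-- Half-width of the confidence interval, `√(2 σ² (N + 2) log t / N_i(t))`. -/
def confWidth {N : ℕ} (σ : ℝ) (p : ℕ → Fin N) (i : Fin N) (t : ℕ) : ℝ :=
  √(2 * σ ^ 2 * (N + 2) * Real.log t / pulls p i t)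

/-- The upper confidence bound `U_i(t)`. -/
def upperConf {N : ℕ} (σ : ℝ) (p : ℕ → Fin N) (x : ℕ → ℝ) (i : Fin N) (t : ℕ) : ℝ :=
  empMean p x i t + confWidth σ p i t

/-- The lower confidence bound `L_i(t)`. -/
def lowerConf {N : ℕ} (σ : ℝ) (p : ℕ → Fin N) (x : ℕ → ℝ) (i : Fin N) (t : ℕ) : ℝ :=
  empMean p x i t - confWidth σ p i t

/-- The estimated gap `max_i max {0, L_i(t) - max_{j ≠ i} U_j(t)}`. -/
def gapEst {N : ℕ} (σ : ℝ) (p : ℕ → Fin N) (x : ℕ → ℝ) (t : ℕ) : ℝ :=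
  ⨆ i : Fin N, max 0 (lowerConf σ p x i t - ⨆ j : {j : Fin N // j ≠ i}, upperConf σ p x j t)

/-- The bias `α(t) = min {Ĉ_α(t), β(t)} log t` with `Ĉ_α(t) = 32 γ (N + 2) / Δ̂_t`, `γ = 8 σ²`,
where `Ĉ_α(t) = ∞` if `Δ̂_t = 0`. -/
def bias {N : ℕ} (σ : ℝ) (β : ℕ → ℝ) (p : ℕ → Fin N) (x : ℕ → ℝ) (t : ℕ) : ℝ :=
  (if gapEst σ p x t = 0 then β t
    else min (32 * (8 * σ ^ 2) * (N + 2) / gapEst σ p x t) (β t)) * Real.log t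

/-- The Gaussian RBMLE index `I(ν, n, α) = ν + α / (2 n)`, for `n ≥ 1`. -/
def index (ν : ℝ) (n : ℕ) (α : ℝ) : ℝ := ν + α / (2 * n)

/-- `a` is an arm that adaptive RBMLE may choose in round `t`: an arm that has not been pulled
yet if there is one (such an arm has index `∞`), and otherwise an arm of maximal index. -/
def IsRBMLEChoice {N : ℕ} (σ : ℝ) (β : ℕ → ℝ) (p : ℕ → Fin N) (x : ℕ → ℝ) (t : ℕ)
    (a : Fin N) : Prop :=
  ((∃ i, pulls p i t = 0) → pulls p a t = 0) ∧
  ((∀ i, pulls p i t ≠ 0) → ∀ i,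
    index (empMean p x i t) (pulls p i t) (bias σ β p x t) ≤
      index (empMean p x a t) (pulls p a t) (bias σ β p x t))

/-- In every round the arm is chosen by adaptive RBMLE (ties broken in any way, possibly at
random). -/
def FollowsRBMLE {N : ℕ} {Ω : Type*} [MeasurableSpace Ω] (P : Measure Ω) (σ : ℝ) (β : ℕ → ℝ)
    (π : ℕ → Ω → Fin N) (X : ℕ → Ω → ℝ) : Prop :=
  ∀ t, 1 ≤ t → ∀ᵐ ω ∂P, IsRBMLEChoice σ β (fun s => π s ω) (fun s => X s ω) t (π t ω)

/-- `T₀ = min {t ≥ 1 : β(t) ≥ 32 γ (N + 2) / Δ}` with `γ = 8 σ²`. -/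
def burnIn {N : ℕ} (σ : ℝ) (β : ℕ → ℝ) (D : Fin N → Measure ℝ) (b : Fin N) : ℕ :=
  sInf {t : ℕ | 1 ≤ t ∧ 32 * (8 * σ ^ 2) * (N + 2) / minGap D b ≤ β t}

end

end Bandit

/-! Write `w_i` for the confidence width. The bonus `α(t) / (2 N_i(t))` equals `κ * w_i²` for a `κ`
common to all arms, so the index comparison is a comparison of squared widths. Call a round good if
every empirical mean is within `w_i` of its true mean.

In a good round the estimated gap is at most `Δ`. Once `β` has passed its threshold, this gives `κ ≥
64 / Δ`. Suppose a suboptimal arm `a` with many pulls, hence with small `w_a`, had maximal index.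
Then every other arm has either a width at most `w_a` or a small upper confidence bound. This makes
the lower bound of `b` clear all other upper bounds by at least `Δ / 2`. So the estimated gap is at
least `Δ / 2`, however large `β` is, and `κ ≤ 128 / Δ`; the bonus of `a` is then too small to beat
`b`. This is `not_isRBMLEChoice`.

Bad rounds are rare (`IsPlay.exists_event_confWidth`), by exponential supermartingales and a union
bound over arms, signs and pull counts. Hence the pulls of `a` are bounded by a threshold, plus one,
plus the number of bad rounds, whose probabilities are summable. The decomposition
`IsPlay.regret_eq` turns this into the regret bound. -/

namespace Bandit

/-! ### Gaps -/

section Gap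

variable {N : ℕ} (D : Fin N → Measure ℝ) (b : Fin N)

lemma nonempty_ne (hN : 2 ≤ N) (i : Fin N) : Nonempty {j : Fin N // j ≠ i} := by
  have : Nontrivial (Fin N) := Fin.nontrivial_iff_two_le.mpr hN
  obtain ⟨j, hj⟩ := exists_ne i
  exact ⟨⟨j, hj⟩⟩

lemma exists_minGap_eq (hN : 2 ≤ N) : ∃ a, a ≠ b ∧ minGap D b = gap D b a := by
  have := nonempty_ne hN b
  obtain ⟨a, ha⟩ := exists_eq_ciInf_of_finite (f := fun a : {a : Fin N // a ≠ b} => gap D b a)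
  exact ⟨a, a.2, ha.symm⟩

lemma minGap_le {a : Fin N} (ha : a ≠ b) : minGap D b ≤ gap D b a :=
  ciInf_le (f := fun a : {a : Fin N // a ≠ b} => gap D b a) (Set.finite_range _).bddBelow ⟨a, ha⟩

lemma minGap_pos (hN : 2 ≤ N) (hb : ∀ a, a ≠ b → armMean D a < armMean D b) :
    0 < minGap D b := by
  obtain ⟨a, ha, h⟩ := exists_minGap_eq D b hN
  rw [h, gap]
  linarith [hb a ha]

end Gap

/-! ### The confidence bounds and the estimated gap -/

section Conf

variable {N : ℕ} {σ : ℝ} {p : ℕ → Fin N} {x : ℕ → ℝ} {t : ℕ}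

lemma confWidth_nonneg (i : Fin N) : 0 ≤ confWidth σ p i t := Real.sqrt_nonneg _

lemma confWidth_sq (i : Fin N) :
    confWidth σ p i t ^ 2 = 2 * (σ ^ 2 * (N + 2)) * Real.log t / pulls p i t := by
  rw [confWidth, Real.sq_sqrt (by positivity)]
  ring

lemma index_eq_add_confWidth_sq (hσ : 0 < σ) (ν c : ℝ) (i : Fin N) :
    index ν (pulls p i t) (c * Real.log t) =
      ν + c / (4 * (σ ^ 2 * (N + 2))) * confWidth σ p i t ^ 2 := by
  rw [confWidth_sq, index]
  have : (0 : ℝ) < N + 2 := by positivity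
  -- Without pulls both bonuses are divisions by zero, hence `0`.
  by_cases h : (pulls p i t : ℝ) = 0
  · simp [h]
  · field_simp
    ring

lemma gapEst_nonneg (hN : 2 ≤ N) : 0 ≤ gapEst σ p x t := by
  have i : Fin N := ⟨0, by omega⟩
  exact (le_max_left 0 _).trans (le_ciSup (f := fun i : Fin N => max 0
    (lowerConf σ p x i t - ⨆ j : {j : Fin N // j ≠ i}, upperConf σ p x j t))
    (Set.finite_range _).bddAbove i)

lemma le_gapEst (i : Fin N) :
    lowerConf σ p x i t - ⨆ j : {j : Fin N // j ≠ i}, upperConf σ p x j t ≤ gapEst σ p x t :=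
  (le_max_right 0 _).trans (le_ciSup (f := fun i : Fin N => max 0
    (lowerConf σ p x i t - ⨆ j : {j : Fin N // j ≠ i}, upperConf σ p x j t))
    (Set.finite_range _).bddAbove i)

lemma upperConf_le_iSup {i j : Fin N} (h : j ≠ i) :
    upperConf σ p x j t ≤ ⨆ j : {j : Fin N // j ≠ i}, upperConf σ p x j t :=
  le_ciSup (f := fun j : {j : Fin N // j ≠ i} => upperConf σ p x j t)
    (Set.finite_range _).bddAbove ⟨j, h⟩

variable {D : Fin N → Measure ℝ} {b : Fin N}

/-- For `i = b`, the upper bound of a closest competitor is at least its mean. For `i ≠ b`, the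
upper bound of `b` already exceeds the lower bound of `i`, so the difference is negative. -/
lemma gapEst_le_minGap (hN : 2 ≤ N) (hb : ∀ a, a ≠ b → armMean D a < armMean D b)
    (hgood : ∀ i, |empMean p x i t - armMean D i| ≤ confWidth σ p i t) :
    gapEst σ p x t ≤ minGap D b := by
  have : Nonempty (Fin N) := ⟨b⟩
  have hpos := minGap_pos D b hN hb
  have hU (i : Fin N) : armMean D i ≤ upperConf σ p x i t := by
    have := abs_le.mp (hgood i)
    rw [upperConf]; linarith
  have hL (i : Fin N) : lowerConf σ p x i t ≤ armMean D i := by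
    have := abs_le.mp (hgood i)
    rw [lowerConf]; linarith
  refine ciSup_le fun i => max_le hpos.le ?_
  by_cases hi : i = b
  · subst hi
    obtain ⟨a, ha, h⟩ := exists_minGap_eq D i hN
    have := upperConf_le_iSup (σ := σ) (p := p) (x := x) (t := t) ha
    rw [h, gap]
    linarith [hU a, hL i]
  · have := upperConf_le_iSup (σ := σ) (p := p) (x := x) (t := t) (Ne.symm hi)
    linarith [hU b, hL i, hb i hi]

/-- On the event that all confidence intervals are valid, adaptive RBMLE does not choose a
suboptimal arm that was pulled often, once `β` has passed the threshold. -/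
lemma not_isRBMLEChoice (hN : 2 ≤ N) (hσ : 0 < σ)
    (hb : ∀ a, a ≠ b → armMean D a < armMean D b) {β : ℕ → ℝ} {a : Fin N} (ha : a ≠ b)
    (hgood : ∀ i, |empMean p x i t - armMean D i| ≤ confWidth σ p i t)
    (hpull : ∀ i, pulls p i t ≠ 0)
    (hlog : 0 < Real.log t)
    (hβ : 32 * (8 * σ ^ 2) * (N + 2) / minGap D b ≤ β t)
    (hn : 128 * (8 * σ ^ 2) * (N + 2) / minGap D b ^ 2 * Real.log t ≤ pulls p a t) :
    ¬ IsRBMLEChoice σ β p x t a := by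
  intro hchoice
  have hΔ := minGap_pos D b hN hb
  have hest := gapEst_le_minGap hN hb hgood
  have hest0 := gapEst_nonneg (σ := σ) (p := p) (x := x) (t := t) hN
  set Δ := minGap D b with hΔdef
  have hgap (j : Fin N) (hj : j ≠ b) : Δ ≤ armMean D b - armMean D j := minGap_le D b hj
  set A : ℝ := σ ^ 2 * (N + 2) with hA
  have hApos : 0 < A := by positivity
  obtain ⟨c, hc, hcdef⟩ : ∃ c, bias σ β p x t = c * Real.log t ∧
      c = if gapEst σ p x t = 0 then β t
        else min (32 * (8 * σ ^ 2) * (N + 2) / gapEst σ p x t) (β t) := ⟨_, rfl, rfl⟩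
  have hc_lower : 256 * A / Δ ≤ c := by
    have e : 256 * A / Δ = 32 * (8 * σ ^ 2) * (N + 2) / Δ := by rw [hA]; ring
    rw [hcdef, e]
    split_ifs with h0
    · exact hβ
    · refine le_min ?_ hβ
      have : 0 < gapEst σ p x t := lt_of_le_of_ne hest0 (Ne.symm h0)
      gcongr
  set κ := c / (4 * A) with hκ
  have hκ_lower : 64 / Δ ≤ κ := by
    rw [hκ, le_div_iff₀ (by positivity)]
    calc 64 / Δ * (4 * A) = 256 * A / Δ := by ring
      _ ≤ c := hc_lower
  have hind (j : Fin N) : empMean p x j t + κ * confWidth σ p j t ^ 2 ≤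
      empMean p x a t + κ * confWidth σ p a t ^ 2 := by
    have := hchoice.2 hpull j
    rwa [hc, index_eq_add_confWidth_sq hσ, index_eq_add_confWidth_sq hσ] at this
  -- The pull threshold is `1024 * A * log t / Δ²`, and `w_a² = 2 * A * log t / n`.
  have hwa_sq : confWidth σ p a t ^ 2 ≤ Δ ^ 2 / 512 := by
    have hpos : (0 : ℝ) < pulls p a t := by exact_mod_cast Nat.pos_of_ne_zero (hpull a)
    rw [confWidth_sq, div_le_iff₀ hpos, ← hA]
    calc 2 * A * Real.log t
        = Δ ^ 2 / 512 * (128 * (8 * σ ^ 2) * (N + 2) / Δ ^ 2 * Real.log t) := by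
          rw [hA]; field_simp; norm_num
      _ ≤ _ := by gcongr
  have hw (j : Fin N) : 0 ≤ confWidth σ p j t := confWidth_nonneg j
  -- `22² = 484 < 512`.
  have hwa : confWidth σ p a t ≤ Δ / 22 := by
    refine abs_le_of_sq_le_sq' ?_ (by positivity) |>.2
    nlinarith [sq_nonneg Δ]
  have hg (j : Fin N) := abs_le.mp (hgood j)
  -- An arm wider than `a` pays for its larger bonus with a smaller empirical mean. Completing the
  -- square, `w ≤ (64 / Δ) * w² + Δ / 256`, converts the quadratic bonus into the linear width of
  -- the upper confidence bound.
  have hkey (j : Fin N) : confWidth σ p j t ≤ confWidth σ p a t ∨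
      empMean p x j t + confWidth σ p j t ≤ empMean p x a t + Δ / 8 + Δ / 256 := by
    refine (le_or_gt (confWidth σ p j t) (confWidth σ p a t)).imp_right fun hlt => ?_
    have h1 : confWidth σ p a t ^ 2 ≤ confWidth σ p j t ^ 2 :=
      pow_le_pow_left₀ (hw a) hlt.le 2
    have h2 := mul_le_mul_of_nonneg_right hκ_lower (sub_nonneg.mpr h1)
    have h3 : 64 / Δ * confWidth σ p a t ^ 2 ≤ Δ / 8 := by
      calc 64 / Δ * confWidth σ p a t ^ 2 ≤ 64 / Δ * (Δ ^ 2 / 512) := by gcongr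
        _ = Δ / 8 := by field_simp; norm_num
    have h4 : confWidth σ p j t ≤ 64 / Δ * confWidth σ p j t ^ 2 + Δ / 256 := by
      have e : 64 / Δ * confWidth σ p j t ^ 2 + Δ / 256 - confWidth σ p j t =
          64 / Δ * (confWidth σ p j t - Δ / 128) ^ 2 := by field_simp; ring
      have : 0 ≤ 64 / Δ * (confWidth σ p j t - Δ / 128) ^ 2 := by positivity
      linarith
    linarith [hind j]
  -- Otherwise the upper bound of `b` would lie below `θ_b`.
  have hwb : confWidth σ p b t ≤ confWidth σ p a t := by
    refine (hkey b).resolve_right fun h => ?_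
    linarith [hg a, hg b, hgap a ha]
  have hUsup : ⨆ j : {j : Fin N // j ≠ b}, upperConf σ p x j t ≤ armMean D b - 3 / 4 * Δ := by
    have := nonempty_ne hN b
    refine ciSup_le fun j => ?_
    rw [upperConf]
    rcases hkey j with h | h
    · linarith [hg j, hgap j j.2]
    · linarith [hg a, hgap a ha]
  -- The lower bound of `b` is at least `θ_b - 2 * w_a ≥ θ_b - Δ / 11`, and `3 / 4 - 1 / 11 > 1 /
  -- 2`.
  have hest_lower : Δ / 2 ≤ gapEst σ p x t := by
    have := le_gapEst (σ := σ) (p := p) (x := x) (t := t) b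
    rw [lowerConf] at this
    linarith [hg b]
  have hc_upper : c ≤ 512 * A / Δ := by
    have hpos : 0 < gapEst σ p x t := by linarith
    rw [hcdef, if_neg hpos.ne']
    refine (min_le_left _ _).trans ?_
    calc 32 * (8 * σ ^ 2) * (N + 2) / gapEst σ p x t
        ≤ 32 * (8 * σ ^ 2) * (N + 2) / (Δ / 2) := by gcongr
      _ = 512 * A / Δ := by rw [hA]; field_simp; norm_num
  have hκ_upper : κ * confWidth σ p a t ^ 2 ≤ Δ / 4 := by
    have : κ ≤ 128 / Δ := by
      rw [hκ, div_le_iff₀ (by positivity)]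
      calc c ≤ 512 * A / Δ := hc_upper
        _ = _ := by ring
    calc κ * confWidth σ p a t ^ 2 ≤ 128 / Δ * (Δ ^ 2 / 512) := by gcongr
      _ = Δ / 4 := by field_simp; norm_num
  have hκ0 : 0 ≤ κ * confWidth σ p b t ^ 2 := by
    have : 0 ≤ κ := le_trans (by positivity) hκ_lower
    positivity
  linarith [hind b, hg a, hg b, hgap a ha]

end Conf

/-! ### Counting pulls -/

section Pulls

variable {N : ℕ} (p : ℕ → Fin N)

lemma pulls_succ (i : Fin N) {t : ℕ} (ht : 1 ≤ t) :
    pulls p i (t + 1) = pulls p i t + if p t = i then 1 else 0 := by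
  rw [pulls, pulls, ← Finset.insert_Ico_right_eq_Ico_add_one ht, Finset.filter_insert]
  split_ifs <;> simp

lemma pulls_le (i : Fin N) (t : ℕ) : pulls p i t ≤ t - 1 :=
  (Finset.card_filter_le _ _).trans_eq (Nat.card_Ico 1 t)

@[simp] lemma pulls_one (i : Fin N) : pulls p i 1 = 0 := by simp [pulls]

lemma pulls_eq_sum (i : Fin N) (T : ℕ) :
    (pulls p i (T + 1) : ℝ) = ∑ t ∈ Finset.Icc 1 T, if p t = i then 1 else 0 := by
  rw [pulls, Finset.card_filter]
  push_cast
  rfl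

/-- If arm `i` is pulled in a round `t` with at least `u` previous pulls only when `t ∈ B`, then
the number of pulls is at most `u + 1` plus the number of rounds in `B`. -/
lemma pulls_le_add_sum_indicator (i : Fin N) {u : ℝ} (hu : 0 ≤ u) {B : Set ℕ} {T : ℕ}
    (h : ∀ t ∈ Finset.Icc 1 T, p t = i → u ≤ pulls p i t → t ∈ B) :
    (pulls p i (T + 1) : ℝ) ≤ u + 1 + ∑ t ∈ Finset.Icc 1 T, B.indicator 1 t := by
  induction T with
  | zero => simp; linarith
  | succ T ih =>
    specialize ih fun t ht => h t (Finset.Icc_subset_Icc_right (Nat.le_succ T) ht)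
    have hT : T + 1 ∈ Finset.Icc 1 (T + 1) := by simp
    have hB0 : ∀ s, 0 ≤ B.indicator (1 : ℕ → ℝ) s := fun s =>
      Set.indicator_nonneg (fun _ _ => zero_le_one) s
    rw [pulls_succ _ _ (Nat.le_add_left 1 T)]
    rw [Finset.sum_Icc_succ_top (by omega)]
    push_cast
    split_ifs with hp
    · rcases le_or_gt u (pulls p i (T + 1)) with h1 | h1
      · rw [Set.indicator_of_mem (h _ hT hp h1)]
        simp only [Pi.one_apply]
        linarith
      · have := Finset.sum_nonneg fun s (_ : s ∈ Finset.Icc 1 T) => hB0 s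
        linarith [hB0 (T + 1)]
    · linarith [hB0 (T + 1)]

end Pulls

/-! ### Conditioning on the history -/

section Play

variable {N : ℕ} {Ω : Type*} [MeasurableSpace Ω] {P : Measure Ω}
  {D : Fin N → Measure ℝ}
  {π : ℕ → Ω → Fin N} {X : ℕ → Ω → ℝ}

lemma IsPlay.measurable_history (h : IsPlay P D π X) (t : ℕ) : Measurable (history π X t) := by
  refine measurable_pi_lambda _ fun s => ?_
  have hs := (Finset.mem_Ico.mp s.2).1
  exact (h.measurable_arm s hs).prodMk (h.measurable_reward s hs)

/-- The logarithm of the exponential supermartingale of arm `i` with parameter `l`. -/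
noncomputable def logMart (D : Fin N → Measure ℝ) (σ : ℝ) (i : Fin N) (l : ℝ)
    (p : ℕ → Fin N) (x : ℕ → ℝ) (t : ℕ) : ℝ :=
  ∑ s ∈ Finset.Ico 1 t, if p s = i then l * (x s - armMean D i) - l ^ 2 * σ ^ 2 / 2 else 0

lemma logMart_succ (σ : ℝ) (i : Fin N) (l : ℝ) (p : ℕ → Fin N) (x : ℕ → ℝ) {t : ℕ} (ht : 1 ≤ t) :
    logMart D σ i l p x (t + 1) = logMart D σ i l p x t +
      if p t = i then l * (x t - armMean D i) - l ^ 2 * σ ^ 2 / 2 else 0 :=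
  Finset.sum_Ico_succ_top ht _

/-- For fixed `l`, a large value of the process is thus a deviation of the empirical mean, with the
pull count as a factor. -/
lemma logMart_eq (σ : ℝ) (i : Fin N) (l : ℝ) (p : ℕ → Fin N) (x : ℕ → ℝ) {t : ℕ}
    (h : pulls p i t ≠ 0) :
    logMart D σ i l p x t =
      pulls p i t * (l * (empMean p x i t - armMean D i) - l ^ 2 * σ ^ 2 / 2) := by
  have h' : (pulls p i t : ℝ) ≠ 0 := by exact_mod_cast h
  have hsum : (pulls p i t : ℝ) * empMean p x i t =
      ∑ s ∈ (Finset.Ico 1 t).filter (fun s => p s = i), x s := by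
    rw [empMean, mul_div_cancel₀ _ h']
  rw [logMart, ← Finset.sum_filter, Finset.sum_sub_distrib, ← Finset.mul_sum,
    Finset.sum_sub_distrib, ← hsum, Finset.sum_const, Finset.sum_const, ← pulls]
  simp only [nsmul_eq_mul]
  ring

lemma IsPlay.measurable_logMart (h : IsPlay P D π X) (σ : ℝ) (i : Fin N) (l : ℝ) (t : ℕ) :
    Measurable fun ω => logMart D σ i l (fun s => π s ω) (fun s => X s ω) t := by
  refine Finset.measurable_sum _ fun s hs => ?_
  have hs := (Finset.mem_Ico.mp hs).1
  have := h.measurable_reward s hs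
  exact Measurable.ite (h.measurable_arm s hs (measurableSet_singleton i)) (by fun_prop)
    measurable_const

variable [IsProbabilityMeasure P] [∀ i, IsProbabilityMeasure (D i)]

/-- Conditioning in the form needed below: the joint law is the composition product of the law of
history and arm with the reward kernel. -/
lemma IsPlay.lintegral_eq (h : IsPlay P D π X) {t : ℕ} (ht : 1 ≤ t)
    {f : ((Finset.Ico 1 t → Fin N × ℝ) × Fin N) × ℝ → ENNReal} (hf : Measurable f) :
    ∫⁻ ω, f ((history π X t ω, π t ω), X t ω) ∂P =
      ∫⁻ ω, ∫⁻ x, f ((history π X t ω, π t ω), x) ∂(D (π t ω)) ∂P := by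
  have hm : Measurable fun ω => (history π X t ω, π t ω) :=
    (h.measurable_history t).prodMk (h.measurable_arm t ht)
  have hlaw := h.reward_law t ht
  rw [← lintegral_map (g := fun ω => ((history π X t ω, π t ω), X t ω)) hf
      (hm.prodMk (h.measurable_reward t ht)), HasLaw.map_eq hlaw,
    Measure.lintegral_compProd hf, lintegral_map hf.lintegral_kernel_prod_right' hm]
  rfl

lemma IsPlay.integrable_reward (h : IsPlay P D π X) (hD : ∀ i, Integrable (fun x => x) (D i))
    {t : ℕ} (ht : 1 ≤ t) : Integrable (X t) P := by
  refine ⟨(h.measurable_reward t ht).aestronglyMeasurable, ?_⟩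
  rw [HasFiniteIntegral, h.lintegral_eq ht (f := fun p => ‖p.2‖ₑ) (by fun_prop)]
  calc ∫⁻ ω, ∫⁻ x, ‖x‖ₑ ∂(D (π t ω)) ∂P
      ≤ ∫⁻ _, ∑ i, ∫⁻ x, ‖x‖ₑ ∂(D i) ∂P :=
        lintegral_mono fun ω => Finset.single_le_sum
          (f := fun i => ∫⁻ x, ‖x‖ₑ ∂(D i)) (fun _ _ => zero_le) (Finset.mem_univ (π t ω))
    _ < ⊤ := by
      rw [lintegral_const, measure_univ, mul_one]
      exact ENNReal.sum_lt_top.mpr fun i _ => (hD i).2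

lemma IsPlay.integral_reward (h : IsPlay P D π X) (hD : ∀ i, Integrable (fun x => x) (D i))
    {t : ℕ} (ht : 1 ≤ t) : ∫ ω, X t ω ∂P = ∫ ω, armMean D (π t ω) ∂P := by
  have hm : Measurable fun ω => (history π X t ω, π t ω) :=
    (h.measurable_history t).prodMk (h.measurable_arm t ht)
  have hmX := hm.prodMk (h.measurable_reward t ht)
  have hlaw := HasLaw.map_eq (h.reward_law t ht)
  have hint : Integrable (fun p : ((Finset.Ico 1 t → Fin N × ℝ) × Fin N) × ℝ => p.2)
      (P.map (fun ω => (history π X t ω, π t ω)) ⊗ₘ rewardKernel D _) := by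
    rw [← hlaw, integrable_map_measure (by fun_prop) hmX.aemeasurable]
    exact h.integrable_reward hD ht
  calc ∫ ω, X t ω ∂P
      = ∫ p, p.2 ∂(P.map fun ω => ((history π X t ω, π t ω), X t ω)) :=
        (integral_map (f := fun p => p.2) hmX.aemeasurable
          measurable_snd.aestronglyMeasurable).symm
    _ = ∫ q, armMean D q.2 ∂(P.map fun ω => (history π X t ω, π t ω)) := by
        rw [hlaw, Measure.integral_compProd hint]
        rfl
    _ = _ := integral_map hm.aemeasurable (by fun_prop)

/-! ### Concentration of the empirical means -/

lemma lintegral_exp_sub_le_one {μ : Measure ℝ} [IsProbabilityMeasure μ] {m : ℝ} {σ : ℝ≥0}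
    (h : HasSubgaussianMGF (fun x => x - m) (σ ^ 2) μ) (l : ℝ) :
    ∫⁻ x, ENNReal.ofReal (Real.exp (l * (x - m) - l ^ 2 * (σ : ℝ) ^ 2 / 2)) ∂μ ≤ 1 := by
  have e (x : ℝ) : Real.exp (l * (x - m) - l ^ 2 * (σ : ℝ) ^ 2 / 2) =
      Real.exp (l * (x - m)) * Real.exp (-(l ^ 2 * (σ : ℝ) ^ 2 / 2)) := by
    rw [← Real.exp_add]; ring_nf
  simp_rw [e]
  rw [← ofReal_integral_eq_lintegral_ofReal ((h.integrable_exp_mul l).mul_const _)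
    (Eventually.of_forall fun x => by positivity), integral_mul_const]
  refine ENNReal.ofReal_le_one.mpr ?_
  calc _ ≤ Real.exp (((σ ^ 2 : ℝ≥0) : ℝ) * l ^ 2 / 2) * Real.exp (-(l ^ 2 * (σ : ℝ) ^ 2 / 2)) := by
        gcongr
        exact h.mgf_le l
    _ = 1 := by
        rw [← Real.exp_add, NNReal.coe_pow, ← Real.exp_zero]
        ring_nf

lemma IsPlay.lintegral_exp_logMart_le_one (h : IsPlay P D π X) {σ : ℝ≥0}
    (hD : ∀ i, HasSubgaussianMGF (fun x : ℝ => x - armMean D i) (σ ^ 2) (D i))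
    (i : Fin N) (l : ℝ) {t : ℕ} (ht : 1 ≤ t) :
    ∫⁻ ω, ENNReal.ofReal (Real.exp (logMart D σ i l (fun s => π s ω) (fun s => X s ω) t)) ∂P
      ≤ 1 := by
  induction t, ht using Nat.le_induction with
  | base => simp [logMart]
  | succ t ht ih =>
    set F : Fin N × ℝ → ℝ := fun q =>
      if q.1 = i then l * (q.2 - armMean D i) - l ^ 2 * (σ : ℝ) ^ 2 / 2 else 0 with hF
    have hFm : Measurable F := Measurable.ite
      (measurable_fst (measurableSet_singleton i)) (by fun_prop) measurable_const
    -- The process at time `t` is a function of the history alone, so conditioning leaves only the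
    -- last factor to integrate, and its conditional mean is at most `1`.
    set G : (Finset.Ico 1 t → Fin N × ℝ) → ENNReal := fun q =>
      ENNReal.ofReal (Real.exp (∑ s, F (q s))) with hG
    have hGm : Measurable G := by fun_prop
    have hlog (ω : Ω) : ENNReal.ofReal
        (Real.exp (logMart D σ i l (fun s => π s ω) (fun s => X s ω) t)) =
        G (history π X t ω) := by
      exact congrArg (fun r => ENNReal.ofReal (Real.exp r))
        (Finset.sum_coe_sort (Finset.Ico 1 t) fun s => F (π s ω, X s ω)).symm
    have hstep (j : Fin N) : ∫⁻ x, ENNReal.ofReal (Real.exp (F (j, x))) ∂(D j) ≤ 1 := by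
      by_cases hj : j = i
      · subst hj
        simpa [hF] using lintegral_exp_sub_le_one (hD j) l
      · simp [hF, hj]
    calc _ = ∫⁻ ω, G (history π X t ω) * ENNReal.ofReal (Real.exp (F (π t ω, X t ω))) ∂P := by
          refine lintegral_congr fun ω => ?_
          rw [logMart_succ _ _ _ _ _ ht, Real.exp_add, ENNReal.ofReal_mul (Real.exp_nonneg _),
            hlog]
      _ = ∫⁻ ω, ∫⁻ x, G (history π X t ω) *
            ENNReal.ofReal (Real.exp (F (π t ω, x))) ∂(D (π t ω)) ∂P :=
          h.lintegral_eq ht (f := fun q => G q.1.1 * ENNReal.ofReal (Real.exp (F (q.1.2, q.2))))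
            (by fun_prop)
      _ ≤ ∫⁻ ω, G (history π X t ω) ∂P := by
          refine lintegral_mono fun ω => ?_
          rw [lintegral_const_mul _ (by fun_prop)]
          exact mul_le_of_le_one_right' (hstep _)
      _ ≤ 1 := by
          simp_rw [← hlog]
          exact ih

lemma IsPlay.measureReal_le_logMart_le (h : IsPlay P D π X) {σ : ℝ≥0}
    (hD : ∀ i, HasSubgaussianMGF (fun x : ℝ => x - armMean D i) (σ ^ 2) (D i))
    (i : Fin N) (l r : ℝ) {t : ℕ} (ht : 1 ≤ t) :
    P.real {ω | r ≤ logMart D σ i l (fun s => π s ω) (fun s => X s ω) t} ≤ Real.exp (-r) := by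
  refine ENNReal.toReal_le_of_le_ofReal (Real.exp_nonneg _) ?_
  have hm := h.measurable_logMart (σ : ℝ) i l t
  have h1 := meas_ge_le_lintegral_div (μ := P) (ε := ENNReal.ofReal (Real.exp r))
    (f := fun ω => ENNReal.ofReal
      (Real.exp (logMart D σ i l (fun s => π s ω) (fun s => X s ω) t)))
    hm.exp.ennreal_ofReal.aemeasurable (by simp [Real.exp_pos]) ENNReal.ofReal_ne_top
  calc P {ω | r ≤ logMart D σ i l (fun s => π s ω) (fun s => X s ω) t}
      ≤ P {ω | ENNReal.ofReal (Real.exp r) ≤ ENNReal.ofReal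
          (Real.exp (logMart D σ i l (fun s => π s ω) (fun s => X s ω) t))} :=
        measure_mono fun ω hω => ENNReal.ofReal_le_ofReal (Real.exp_le_exp.mpr hω)
    _ ≤ _ := h1
    _ ≤ 1 / ENNReal.ofReal (Real.exp r) := by
        gcongr
        exact h.lintegral_exp_logMart_le_one hD i l ht
    _ = ENNReal.ofReal (Real.exp (-r)) := by
        rw [Real.exp_neg, ENNReal.ofReal_inv_of_pos (Real.exp_pos r), one_div]

/-- Outside of a small event, all confidence intervals in round `t` are valid. -/
lemma IsPlay.exists_event_confWidth (h : IsPlay P D π X) {σ : ℝ≥0} (hσ : 0 < σ)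
    (hD : ∀ i, HasSubgaussianMGF (fun x : ℝ => x - armMean D i) (σ ^ 2) (D i))
    {t : ℕ} (ht : 1 ≤ t) :
    ∃ B : Set Ω, MeasurableSet B ∧ P.real B ≤ 2 * N * (((t : ℝ) - 1) / (t : ℝ) ^ (N + 2)) ∧
      ∀ ω ∉ B, ∀ i, pulls (fun s => π s ω) i t ≠ 0 →
        |empMean (fun s => π s ω) (fun s => X s ω) i t - armMean D i| ≤
          confWidth σ (fun s => π s ω) i t := by
  have htpos : (0 : ℝ) < t := by exact_mod_cast ht
  have hlog : 0 ≤ Real.log t := Real.log_nonneg (by exact_mod_cast ht)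
  have hσ' : (0 : ℝ) < σ := hσ
  set w : ℕ → ℝ := fun n => √(2 * (σ : ℝ) ^ 2 * (N + 2) * Real.log t / n) with hw
  set E : Fin N → ℝ → Set Ω := fun i l =>
    {ω | (N + 2) * Real.log t ≤ logMart D σ i l (fun s => π s ω) (fun s => X s ω) t} with hE
  have hEm (i : Fin N) (l : ℝ) : MeasurableSet (E i l) :=
    measurableSet_le measurable_const (h.measurable_logMart _ _ _ _)
  have hexp : Real.exp (-((N + 2) * Real.log t)) = 1 / (t : ℝ) ^ (N + 2) := by
    rw [Real.exp_neg, mul_comm, Real.exp_mul, Real.exp_log htpos, one_div]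
    norm_cast
  have hEP (i : Fin N) (l : ℝ) : P.real (E i l) ≤ 1 / (t : ℝ) ^ (N + 2) :=
    (h.measureReal_le_logMart_le hD i l _ ht).trans_eq hexp
  -- The pull count is random while the supermartingale needs a fixed parameter. Hence the union
  -- over all counts `n` from `1` to `t - 1`, each with its own parameters `±w n / σ²`.
  refine ⟨⋃ i ∈ (Finset.univ : Finset (Fin N)), ⋃ n ∈ Finset.Ico 1 t,
    (E i (w n / (σ : ℝ) ^ 2) ∪ E i (-(w n / (σ : ℝ) ^ 2))), ?_, ?_, ?_⟩
  · exact Finset.measurableSet_biUnion _ fun i _ => Finset.measurableSet_biUnion _ fun n _ =>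
      (hEm _ _).union (hEm _ _)
  · calc _ ≤ ∑ i : Fin N, P.real (⋃ n ∈ Finset.Ico 1 t,
          (E i (w n / (σ : ℝ) ^ 2) ∪ E i (-(w n / (σ : ℝ) ^ 2)))) :=
          measureReal_biUnion_finset_le _ _
      _ ≤ ∑ i : Fin N, ∑ n ∈ Finset.Ico 1 t, (2 * (1 / (t : ℝ) ^ (N + 2))) := by
          refine Finset.sum_le_sum fun i _ => (measureReal_biUnion_finset_le _ _).trans ?_
          refine Finset.sum_le_sum fun n _ => (measureReal_union_le _ _).trans ?_
          linarith [hEP i (w n / (σ : ℝ) ^ 2), hEP i (-(w n / (σ : ℝ) ^ 2))]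
      _ = _ := by
          simp only [Finset.sum_const, Nat.card_Ico, Finset.card_univ, Fintype.card_fin,
            nsmul_eq_mul, Nat.cast_sub ht, Nat.cast_one]
          ring
  · intro ω hω i hi
    simp only [Set.mem_iUnion, not_exists, Set.mem_union, not_or] at hω
    set p := fun s => π s ω
    set x := fun s => X s ω
    set n := pulls p i t with hn
    have hnpos : (0 : ℝ) < n := by exact_mod_cast Nat.pos_of_ne_zero hi
    have hmem : n ∈ Finset.Ico 1 t := by
      have := pulls_le p i t
      rw [Finset.mem_Ico]
      omega
    obtain ⟨h1, h2⟩ := hω i (Finset.mem_univ i) n hmem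
    have hwn : confWidth σ p i t = w n := rfl
    have hw0 : 0 ≤ w n := Real.sqrt_nonneg _
    have hwsq : n * w n ^ 2 = 2 * ((N + 2) * Real.log t) * (σ : ℝ) ^ 2 := by
      rw [hw]
      dsimp only
      rw [Real.sq_sqrt (by positivity)]
      field_simp
    -- `l = w n / σ²` maximizes `l * w n - l² * σ² / 2`, with value `(w n)² / (2 * σ²)`.
    have key (d : ℝ) (hd : w n < d) : (N + 2) * Real.log t ≤
        n * (w n / (σ : ℝ) ^ 2 * d - (w n / (σ : ℝ) ^ 2) ^ 2 * (σ : ℝ) ^ 2 / 2) := by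
      calc (N + 2) * Real.log t = n * w n ^ 2 / (2 * (σ : ℝ) ^ 2) := by
            rw [hwsq]; field_simp
        _ = n * (w n / (σ : ℝ) ^ 2 * w n - (w n / (σ : ℝ) ^ 2) ^ 2 * (σ : ℝ) ^ 2 / 2) := by
            field_simp; ring
        _ ≤ _ := by gcongr
    rw [hwn]
    refine abs_le.mpr ⟨?_, ?_⟩
    · by_contra hlt
      refine h2 ?_
      rw [hE, Set.mem_ofPred_eq, logMart_eq _ _ _ _ _ hi]
      refine (key (-(empMean p x i t - armMean D i)) (by linarith)).trans_eq ?_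
      rw [← hn]
      ring
    · by_contra hlt
      refine h1 ?_
      rw [hE, Set.mem_ofPred_eq, logMart_eq _ _ _ _ _ hi]
      exact key _ (by linarith)

end Play

/-! ### Regret and expected numbers of pulls -/

section Regret

variable {N : ℕ} {Ω : Type*} [MeasurableSpace Ω] {P : Measure Ω} [IsProbabilityMeasure P]
  {D : Fin N → Measure ℝ} {π : ℕ → Ω → Fin N} {X : ℕ → Ω → ℝ}

lemma integrable_of_hasSubgaussianMGF_sub {μ : Measure ℝ} [IsProbabilityMeasure μ] {m : ℝ}
    {c : ℝ≥0} (h : HasSubgaussianMGF (fun x => x - m) c μ) : Integrable (fun x => x) μ := by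
  exact (h.integrable.add (integrable_const m)).congr
    (Eventually.of_forall fun x => sub_add_cancel x m)

lemma IsPlay.integrable_arm (h : IsPlay P D π X) (f : Fin N → ℝ) {t : ℕ} (ht : 1 ≤ t) :
    Integrable (fun ω => f (π t ω)) P :=
  Integrable.of_finite.comp_measurable (h.measurable_arm t ht)

lemma IsPlay.integrable_pulls (h : IsPlay P D π X) (a : Fin N) (T : ℕ) :
    Integrable (fun ω => (pulls (fun s => π s ω) a (T + 1) : ℝ)) P := by
  simp_rw [pulls_eq_sum]
  exact integrable_finsetSum _ fun t ht =>
    h.integrable_arm (fun i => if i = a then 1 else 0) (Finset.mem_Icc.mp ht).1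

variable [∀ i, IsProbabilityMeasure (D i)]

lemma IsPlay.regret_eq (h : IsPlay P D π X) (hD : ∀ i, Integrable (fun x => x) (D i))
    (b : Fin N) (T : ℕ) :
    regret P D b X T = ∑ a ∈ Finset.univ.erase b,
      gap D b a * ∫ ω, (pulls (fun s => π s ω) a (T + 1) : ℝ) ∂P := by
  have hgap (i : Fin N) : gap D b i =
      ∑ a ∈ Finset.univ.erase b, gap D b a * if i = a then 1 else 0 := by
    simp only [mul_ite, mul_one, mul_zero, Finset.sum_ite_eq, Finset.mem_erase, Finset.mem_univ,
      and_true]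
    split_ifs with hi
    · rfl
    · simp [not_not.mp hi, gap]
  have hint (t : ℕ) (ht : t ∈ Finset.Icc 1 T) (a : Fin N) :
      Integrable (fun ω => if π t ω = a then (1 : ℝ) else 0) P :=
    h.integrable_arm (fun i => if i = a then 1 else 0) (Finset.mem_Icc.mp ht).1
  calc regret P D b X T
      = ∑ t ∈ Finset.Icc 1 T, ∫ ω, gap D b (π t ω) ∂P := by
        rw [regret, integral_finsetSum _ fun t ht =>
          h.integrable_reward hD (Finset.mem_Icc.mp ht).1]
        have : (T : ℝ) * armMean D b = ∑ t ∈ Finset.Icc 1 T, armMean D b := by simp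
        rw [this, ← Finset.sum_sub_distrib]
        refine Finset.sum_congr rfl fun t ht => ?_
        have ht' := (Finset.mem_Icc.mp ht).1
        simp only [gap]
        rw [integral_sub (integrable_const _) (h.integrable_arm _ ht'),
          h.integral_reward hD ht']
        simp
    _ = ∑ t ∈ Finset.Icc 1 T, ∑ a ∈ Finset.univ.erase b,
          gap D b a * ∫ ω, (if π t ω = a then (1 : ℝ) else 0) ∂P := by
        refine Finset.sum_congr rfl fun t ht => ?_
        calc ∫ ω, gap D b (π t ω) ∂P
            = ∫ ω, ∑ a ∈ Finset.univ.erase b, gap D b a * (if π t ω = a then 1 else 0) ∂P :=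
              integral_congr_ae (Eventually.of_forall fun ω => hgap (π t ω))
          _ = _ := by
              rw [integral_finsetSum _ fun a _ => (hint t ht a).const_mul _]
              simp_rw [integral_const_mul]
    _ = _ := by
        rw [Finset.sum_comm]
        refine Finset.sum_congr rfl fun a _ => ?_
        simp_rw [pulls_eq_sum]
        rw [← Finset.mul_sum, integral_finsetSum _ fun t ht => hint t ht a]

/-- The term `t = 1` vanishes, whence the `- 1`; this saving later absorbs the extra pull in the
counting bound. -/
lemma sum_sub_one_div_pow_le {N T : ℕ} (hN : 2 ≤ N) (hT : 1 ≤ T) :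
    ∑ t ∈ Finset.Icc 1 T, ((t : ℝ) - 1) / (t : ℝ) ^ (N + 2) ≤ Real.pi ^ 2 / 6 - 1 := by
  have hterm (t : ℕ) (ht : t ∈ Finset.Icc 1 T) :
      ((t : ℝ) - 1) / (t : ℝ) ^ (N + 2) ≤ 1 / (t : ℝ) ^ 2 - if t = 1 then 1 else 0 := by
    have ht1 : (1 : ℝ) ≤ t := by exact_mod_cast (Finset.mem_Icc.mp ht).1
    split_ifs with h
    · simp [h]
    · rw [sub_zero, div_le_div_iff₀ (by positivity) (by positivity), one_mul]
      calc ((t : ℝ) - 1) * (t : ℝ) ^ 2 ≤ t * (t : ℝ) ^ 2 := by gcongr; linarith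
        _ = (t : ℝ) ^ 3 := by ring
        _ ≤ (t : ℝ) ^ (N + 2) := pow_le_pow_right₀ ht1 (by omega)
  calc _ ≤ ∑ t ∈ Finset.Icc 1 T, (1 / (t : ℝ) ^ 2 - if t = 1 then 1 else 0) :=
        Finset.sum_le_sum hterm
    _ = ∑ t ∈ Finset.Icc 1 T, 1 / (t : ℝ) ^ 2 - 1 := by
        rw [Finset.sum_sub_distrib, Finset.sum_ite_eq', if_pos (by simp [hT])]
    _ ≤ _ := by
        gcongr
        exact sum_le_hasSum _ (fun _ _ => by positivity) hasSum_zeta_two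

lemma isLeast_burnIn {β : ℕ → ℝ} (hβ : Tendsto β atTop atTop) (σ : ℝ) (D : Fin N → Measure ℝ)
    (b : Fin N) :
    IsLeast {t : ℕ | 1 ≤ t ∧ 32 * (8 * σ ^ 2) * (N + 2) / minGap D b ≤ β t} (burnIn σ β D b) := by
  refine ⟨Nat.sInf_mem ?_, fun t ht => Nat.sInf_le ht⟩
  exact ((eventually_ge_atTop 1).and (hβ.eventually_ge_atTop _)).exists

/-- The expected number of pulls of a suboptimal arm under adaptive RBMLE. -/
lemma IsPlay.integral_pulls_le (hplay : IsPlay P D π X) (hN : 2 ≤ N) {σ : ℝ≥0} (hσ : 0 < σ)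
    (hD : ∀ i, HasSubgaussianMGF (fun x : ℝ => x - armMean D i) (σ ^ 2) (D i))
    {b : Fin N} (hb : ∀ a, a ≠ b → armMean D a < armMean D b)
    {β : ℕ → ℝ} (hβ : MonotoneOn β (Set.Ici 1)) (hβ' : Tendsto β atTop atTop)
    (hπ : FollowsRBMLE P σ β π X) {a : Fin N} (ha : a ≠ b) {T : ℕ} (hT : 1 ≤ T) :
    ∫ ω, (pulls (fun s => π s ω) a (T + 1) : ℝ) ∂P ≤
      max (128 * (8 * (σ : ℝ) ^ 2) * (N + 2) / minGap D b ^ 2 * Real.log T)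
        (burnIn σ β D b : ℝ) + N * Real.pi ^ 2 / 3 := by
  have hσ' : (0 : ℝ) < σ := hσ
  obtain ⟨⟨hT₀, hβT₀⟩, -⟩ := isLeast_burnIn hβ' (σ : ℝ) D b
  set K : ℝ := 128 * (8 * (σ : ℝ) ^ 2) * (N + 2) / minGap D b ^ 2 with hK
  set T₀ := burnIn (σ : ℝ) β D b with hT₀def
  set u : ℝ := max (K * Real.log T) T₀ with hu
  have hu0 : 0 ≤ u := (Nat.cast_nonneg T₀).trans (le_max_right _ _)
  choose! B hBm hBP hB using fun (t : ℕ) (ht : 1 ≤ t) => hplay.exists_event_confWidth hσ hD ht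
  have hpath : ∀ᵐ ω ∂P, (pulls (fun s => π s ω) a (T + 1) : ℝ) ≤
      u + 1 + ∑ t ∈ Finset.Icc 1 T, (B t).indicator 1 ω := by
    have hall : ∀ᵐ ω ∂P, ∀ t, 1 ≤ t →
        IsRBMLEChoice σ β (fun s => π s ω) (fun s => X s ω) t (π t ω) :=
      ae_all_iff.mpr fun t => by
        by_cases ht : 1 ≤ t
        · filter_upwards [hπ t ht] with ω hω _ using hω
        · exact Eventually.of_forall fun ω h => absurd h ht
    filter_upwards [hall] with ω hω
    refine pulls_le_add_sum_indicator (fun s => π s ω) a hu0 (B := {t | ω ∈ B t})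
      fun t ht hta hut => ?_
    obtain ⟨ht1, htT⟩ := Finset.mem_Icc.mp ht
    by_contra hωB
    have hchoice := hω t ht1
    rw [hta] at hchoice
    -- At least `T₀` earlier pulls force `t > T₀`, so `β` has passed its threshold. As `T₀ ≥ 1`, arm
    -- `a` is not new, so its choice means that no arm is unpulled.
    have hT₀n : T₀ ≤ pulls (fun s => π s ω) a t := by
      exact_mod_cast (le_max_right _ _).trans hut
    have hnt := pulls_le (fun s => π s ω) a t
    have hpull (i : Fin N) : pulls (fun s => π s ω) i t ≠ 0 := fun hi => by
      have := hchoice.1 ⟨i, hi⟩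
      omega
    have ht2 : (1 : ℝ) < t := by exact_mod_cast (show 1 < t by omega)
    have hΔ := minGap_pos D b hN hb
    refine not_isRBMLEChoice hN hσ' hb ha (fun i => hB t ht1 ω hωB i (hpull i)) hpull
      (Real.log_pos ht2) ?_ ?_ hchoice
    · exact hβT₀.trans (hβ hT₀ ht1 (by omega))
    · calc K * Real.log t ≤ K * Real.log T := by gcongr
        _ ≤ _ := (le_max_left _ _).trans hut
  have hBint (t : ℕ) (ht : t ∈ Finset.Icc 1 T) : Integrable ((B t).indicator (1 : Ω → ℝ)) P :=
    (integrable_const (1 : ℝ)).indicator (hBm t (Finset.mem_Icc.mp ht).1)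
  have hN' : (2 : ℝ) ≤ N := by exact_mod_cast hN
  calc ∫ ω, (pulls (fun s => π s ω) a (T + 1) : ℝ) ∂P
      ≤ ∫ ω, (u + 1 + ∑ t ∈ Finset.Icc 1 T, (B t).indicator 1 ω) ∂P :=
        integral_mono_ae (hplay.integrable_pulls a T)
          ((integrable_const _).add (integrable_finsetSum _ hBint)) hpath
    _ = u + 1 + ∑ t ∈ Finset.Icc 1 T, P.real (B t) := by
        rw [integral_add (integrable_const _) (integrable_finsetSum _ hBint),
          integral_finsetSum _ hBint]
        congr 1
        · simp
        · exact Finset.sum_congr rfl fun t ht =>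
            integral_indicator_one (hBm t (Finset.mem_Icc.mp ht).1)
    _ ≤ u + 1 + ∑ t ∈ Finset.Icc 1 T, 2 * N * (((t : ℝ) - 1) / (t : ℝ) ^ (N + 2)) := by
        gcongr with t ht
        exact hBP t (Finset.mem_Icc.mp ht).1
    _ ≤ u + 1 + 2 * N * (Real.pi ^ 2 / 6 - 1) := by
        rw [← Finset.mul_sum]
        gcongr
        exact sum_sub_one_div_pow_le hN hT
    -- Uses `1 ≤ 2 * N`.
    _ ≤ u + N * Real.pi ^ 2 / 3 := by linarith

end Regret

end Bandit

theorem mainTheorem3 {N : ℕ} (hN : 2 ≤ N) {Ω : Type*} [MeasurableSpace Ω]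
    (P : Measure Ω) [IsProbabilityMeasure P]
    (D : Fin N → Measure ℝ) [∀ i, IsProbabilityMeasure (D i)]
    (σ : ℝ≥0) (hσ : 0 < σ)
    (hD : ∀ i, HasSubgaussianMGF (fun x : ℝ => x - Bandit.armMean D i) (σ ^ 2) (D i))
    (b : Fin N) (hb : ∀ a, a ≠ b → Bandit.armMean D a < Bandit.armMean D b)
    (β : ℕ → ℝ) (hβ : MonotoneOn β (Set.Ici 1)) (hβ' : Tendsto β atTop atTop)
    (π : ℕ → Ω → Fin N) (X : ℕ → Ω → ℝ) (hplay : Bandit.IsPlay P D π X)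
    (hπ : Bandit.FollowsRBMLE P σ β π X) :
    IsLeast {t : ℕ | 1 ≤ t ∧ 32 * (8 * (σ : ℝ) ^ 2) * (N + 2) / Bandit.minGap D b ≤ β t}
        (Bandit.burnIn σ β D b) ∧
      (∀ T : ℕ, 1 ≤ T →
        Bandit.regret P D b X T ≤
          ∑ a ∈ Finset.univ.erase b, Bandit.gap D b a *
            (max (128 * (8 * (σ : ℝ) ^ 2) * (N + 2) / Bandit.minGap D b ^ 2 * Real.log T)
                (Bandit.burnIn σ β D b : ℝ) + N * Real.pi ^ 2 / 3)) ∧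
      (fun T : ℕ => Bandit.regret P D b X T) =O[atTop] fun T : ℕ => Real.log T := by
  have hreg := hplay.regret_eq
    (fun i => Bandit.integrable_of_hasSubgaussianMGF_sub (hD i)) b
  have hgap (a : Fin N) (ha : a ∈ Finset.univ.erase b) : 0 ≤ Bandit.gap D b a :=
    sub_nonneg.mpr (hb a (Finset.ne_of_mem_erase ha)).le
  have hbound : ∀ T : ℕ, 1 ≤ T → Bandit.regret P D b X T ≤
      ∑ a ∈ Finset.univ.erase b, Bandit.gap D b a *
        (max (128 * (8 * (σ : ℝ) ^ 2) * (N + 2) / Bandit.minGap D b ^ 2 * Real.log T)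
          (Bandit.burnIn σ β D b : ℝ) + N * Real.pi ^ 2 / 3) := by
    intro T hT
    rw [hreg]
    exact Finset.sum_le_sum fun a ha => mul_le_mul_of_nonneg_left
      (hplay.integral_pulls_le hN hσ hD hb hβ hβ' hπ (Finset.ne_of_mem_erase ha) hT) (hgap a ha)
  refine ⟨Bandit.isLeast_burnIn hβ' _ D b, hbound, ?_⟩
  have hlog : Tendsto (fun T : ℕ => Real.log T) atTop atTop :=
    Real.tendsto_log_atTop.comp tendsto_natCast_atTop_atTop
  have hconst (c : ℝ) : (fun _ : ℕ => c) =O[atTop] fun T : ℕ => Real.log T :=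
    (Asymptotics.isLittleO_const_left.mpr (Or.inr (tendsto_norm_atTop_atTop.comp hlog))).isBigO
  have hmax (K c : ℝ) : (fun T : ℕ => max (K * Real.log T) c) =O[atTop]
      fun T : ℕ => Real.log T := by
    refine Asymptotics.IsBigO.trans (Asymptotics.IsBigO.of_norm_le
      (g := fun T : ℕ => ‖K * Real.log T‖ + ‖c‖) fun T => ?_)
      (((Asymptotics.isBigO_refl _ _).const_mul_left K).norm_left.add (hconst ‖c‖))
    exact (abs_max_le_max_abs_abs).trans
      (max_le_add_of_nonneg (abs_nonneg _) (abs_nonneg _))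
  refine Asymptotics.IsBigO.trans (Asymptotics.IsBigO.of_bound 1 ?_)
    (Asymptotics.IsBigO.sum (s := Finset.univ.erase b) fun a _ =>
      ((hmax (128 * (8 * (σ : ℝ) ^ 2) * (N + 2) / Bandit.minGap D b ^ 2)
        (Bandit.burnIn σ β D b)).add (hconst (N * Real.pi ^ 2 / 3))).const_mul_left
          (Bandit.gap D b a))
  filter_upwards [eventually_ge_atTop 1] with T hT
  -- The `O`-bound concerns the absolute value, so the regret must also be bounded below.
  have h0 : 0 ≤ Bandit.regret P D b X T := by
    rw [hreg]
    exact Finset.sum_nonneg fun a ha => mul_nonneg (hgap a ha)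
      (integral_nonneg fun ω => Nat.cast_nonneg _)
  rw [one_mul, Real.norm_of_nonneg h0, Finset.sum_apply]
  exact (hbound T hT).trans (le_abs_self _)
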